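/- Let $n\ge 0$ and let $A_0,A_1,A_2$ be real symmetric $n\times n$ matrices. For real symmetric $n\times n$ matrices $B_0,B_1,B_2$ (in this order), say that \emph{Property $\mathcal{IR}$ holds for $B_0,B_1,B_2$} if there exist real numbers $\mu_1,\mu_2,\mu_3>0$ and vectors $x_1,x_2\in\mathbb{R}^n$ such that (IR.1) the matrix $Z:=B_0+\mu_1B_1+\mu_2B_2+\mu_3I_n$ is positive semidefinite, and the linear span of $x_1,x_2$ equals the null space of $Z$; (IR.2) $x_1^TB_1x_1=x_2^TB_1x_2=0$ and $x_1^TB_1x_2\neq0$; (IR.3) $x_1^TB_2x_1<0<x_2^TB_2x_2$. Then the following two statements are equivalent. (i) Both of the following hold: (i.1) $\max\{x^TA_0x,\;x^TA_1x,\;x^TA_2x\}\ge0$ for all $x\in\mathbb{R}^n$; (i.2) there exists a permutation $(j_0,j_1,j_2)$ of $(0,1,2)$ such that the system $x^TA_{j_0}x<0$, $x^TA_{j_1}x=0$, $x^TA_{j_2}x=0$ has no solution $x\in\mathbb{R}^n$, and Property $\mathcal{IR}$ does not hold for $A_{j_0},A_{j_1},A_{j_2}$. (ii) There exist $\mu_0,\mu_1,\mu_2\ge0$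 with $\mu_0+\mu_1+\mu_2=1$ such that $\mu_0A_0+\mu_1A_1+\mu_2A_2$ is positive semidefinite. -/

import Mathlib

open scoped Matrix

/-- The quadratic form `xᵀ A x` of a real square matrix. -/
def quadForm {n : ℕ} (A : Matrix (Fin n) (Fin n) ℝ) (x : Fin n → ℝ) : ℝ :=
  x ⬝ᵥ (A *ᵥ x)

/-- Property `IR` for three real `n × n` matrices `A₀, A₁, A₂`. The order of the matrices matters.
The null space of a matrix is the kernel of the linear map `x ↦ Z x`. -/
def PropertyIR {n : ℕ} (A₀ A₁ A₂ : Matrix (Fin n) (Fin n) ℝ) : Prop :=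
  ∃ (μ₁ μ₂ μ₃ : ℝ) (x₁ x₂ : Fin n → ℝ), 0 < μ₁ ∧ 0 < μ₂ ∧ 0 < μ₃ ∧
    (A₀ + μ₁ • A₁ + μ₂ • A₂ + μ₃ • (1 : Matrix (Fin n) (Fin n) ℝ)).PosSemidef ∧
    Submodule.span ℝ {x₁, x₂} = LinearMap.ker
      (A₀ + μ₁ • A₁ + μ₂ • A₂ + μ₃ • (1 : Matrix (Fin n) (Fin n) ℝ)).mulVecLin ∧
    quadForm A₁ x₁ = 0 ∧ quadForm A₁ x₂ = 0 ∧ x₁ ⬝ᵥ (A₁ *ᵥ x₂) ≠ 0 ∧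
    quadForm A₂ x₁ < 0 ∧ 0 < quadForm A₂ x₂

/-!
# Semidefinite combinations of three quadratic forms

Property `IR` is incompatible with a semidefinite combination having a positive coefficient at the
first matrix (`not_propertyIR_of_nonneg`): such a combination can be compared with `Z` on the null
space of `Z`. The other implication is semidefinite duality followed by an analysis of the optimal
face.

Suppose no nonnegative combination is semidefinite. The values `(tr (A k * X))ₖ` on the positive
semidefinite `X` of trace one form a compact convex set `densityRange A` in `ℝ³`, which by separation
meets the open negative orthant. Minimizing the first coordinate subject to the other two being
nonpositive, and separating again at the minimum, gives multipliers for which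
`Z = A₀ + μ₁ A₁ + μ₂ A₂ + μ₃ I` is semidefinite with `μ₃ > 0`, together with vectors in `ker Z` whose
`A₁`- and `A₂`-sums are nonpositive and complementary to `μ` (`exists_dual_certificate`). If the strict
system and the system `A₀ < 0, A₁ = A₂ = 0` are both unsolvable, then even `A₀ < 0, A₁ ≤ 0, A₂ ≤ 0`
has no solution (`not_exists_neg_nonpos_nonpos`). Hence `ker Z` contains no nonzero vector with
`A₁, A₂ ≤ 0` and complementary slackness; in particular `A₁` and `A₂` have no common zero there.

The Sturm-Zhang rank-one decomposition (`exists_isotropic_decomposition`) turns the sums over the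
family into single vectors. It shows first that both sums vanish, and then that `A₂` takes both signs
on the isotropic cone of `A₁` in `ker Z`, and conversely, whence `μ₁, μ₂ > 0`. Were `ker Z` more than
the plane of the two isotropic vectors so found, the connectedness of the cone
(`exists_common_zero_of_notMem_span`) would produce a common zero. So `ker Z` is that plane, and
Property `IR` holds.
-/

section

variable {n : ℕ}


/-! ### Quadratic forms of symmetric matrices -/

theorem dotProduct_mulVec_comm_of_isSymm {A : Matrix (Fin n) (Fin n) ℝ} (hA : A.IsSymm)
    (x y : Fin n → ℝ) : x ⬝ᵥ (A *ᵥ y) = y ⬝ᵥ (A *ᵥ x) := by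
  rw [Matrix.dotProduct_mulVec, ← Matrix.mulVec_transpose, hA.eq, dotProduct_comm]

theorem quadForm_smul_add_smul {A : Matrix (Fin n) (Fin n) ℝ} (hA : A.IsSymm) (a b : ℝ)
    (x y : Fin n → ℝ) :
    quadForm A (a • x + b • y) =
      a ^ 2 * quadForm A x + 2 * a * b * (x ⬝ᵥ (A *ᵥ y)) + b ^ 2 * quadForm A y := by
  have h := dotProduct_mulVec_comm_of_isSymm hA y x
  simp only [quadForm, Matrix.mulVec_add, Matrix.mulVec_smul, add_dotProduct, dotProduct_add,
    smul_dotProduct, dotProduct_smul, smul_eq_mul, h]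
  ring

theorem quadForm_smul (A : Matrix (Fin n) (Fin n) ℝ) (a : ℝ) (x : Fin n → ℝ) :
    quadForm A (a • x) = a ^ 2 * quadForm A x := by
  simp only [quadForm, Matrix.mulVec_smul, smul_dotProduct, dotProduct_smul, smul_eq_mul]
  ring

@[simp]
theorem quadForm_zero_right (A : Matrix (Fin n) (Fin n) ℝ) : quadForm A 0 = 0 := by
  simp [quadForm]

theorem quadForm_one (x : Fin n → ℝ) : quadForm 1 x = x ⬝ᵥ x := by
  simp [quadForm]

theorem quadForm_add (A B : Matrix (Fin n) (Fin n) ℝ) (x : Fin n → ℝ) :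
    quadForm (A + B) x = quadForm A x + quadForm B x := by
  simp [quadForm, Matrix.add_mulVec]

theorem quadForm_smul_left (c : ℝ) (A : Matrix (Fin n) (Fin n) ℝ) (x : Fin n → ℝ) :
    quadForm (c • A) x = c * quadForm A x := by
  simp [quadForm, Matrix.smul_mulVec]

theorem quadForm_sum_smul {ι : Type*} [Fintype ι] (μ : ι → ℝ)
    (A : ι → Matrix (Fin n) (Fin n) ℝ) (x : Fin n → ℝ) :
    quadForm (∑ k, μ k • A k) x = ∑ k, μ k * quadForm (A k) x := by
  simp [quadForm, Matrix.sum_mulVec, dotProduct_sum, Matrix.smul_mulVec]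

theorem isSymm_sum_smul {ι : Type*} [Fintype ι] (μ : ι → ℝ)
    {A : ι → Matrix (Fin n) (Fin n) ℝ} (hA : ∀ k, (A k).IsSymm) : (∑ k, μ k • A k).IsSymm := by
  simp only [Matrix.IsSymm, Matrix.transpose_sum, Matrix.transpose_smul, fun k => (hA k).eq]

theorem posSemidef_iff_quadForm_nonneg {A : Matrix (Fin n) (Fin n) ℝ} (hA : A.IsSymm) :
    A.PosSemidef ↔ ∀ x, 0 ≤ quadForm A x := by
  rw [Matrix.posSemidef_iff_dotProduct_mulVec]
  have : A.IsHermitian := by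
    rw [Matrix.IsHermitian, Matrix.conjTranspose_eq_transpose_of_trivial, hA.eq]
  exact ⟨fun h x => h.2 x, fun h => ⟨this, h⟩⟩

@[fun_prop]
theorem continuous_quadForm (A : Matrix (Fin n) (Fin n) ℝ) : Continuous (quadForm A) := by
  unfold quadForm
  fun_prop

/-- On a plane where a form `B` is totally isotropic and `G` changes sign, the two forms have a
common nontrivial zero. -/
theorem exists_common_zero_of_orthogonal {B G : Matrix (Fin n) (Fin n) ℝ} (hB : B.IsSymm)
    {N : Submodule ℝ (Fin n → ℝ)} {x y : Fin n → ℝ} (hx : x ∈ N) (hy : y ∈ N)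
    (hBx : quadForm B x = 0) (hBy : quadForm B y = 0) (hxy : x ⬝ᵥ (B *ᵥ y) = 0)
    (hGx : quadForm G x < 0) (hGy : 0 < quadForm G y) :
    ∃ z ∈ N, z ≠ 0 ∧ quadForm B z = 0 ∧ quadForm G z = 0 := by
  have hc : Continuous fun θ : ℝ => quadForm G (Real.cos θ • x + Real.sin θ • y) := by fun_prop
  obtain ⟨θ, hθ⟩ := mem_range_of_exists_le_of_exists_ge hc (c := 0)
    ⟨0, by simpa using hGx.le⟩ ⟨Real.pi / 2, by simpa using hGy.le⟩
  refine ⟨_, N.add_mem (N.smul_mem _ hx) (N.smul_mem _ hy), fun h0 => ?_, ?_, hθ⟩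
  · have h1 : Real.cos θ • x = (-Real.sin θ) • y := by
      rw [neg_smul]; exact eq_neg_of_add_eq_zero_left h0
    have h2 := congrArg (quadForm G) h1
    rw [quadForm_smul, quadForm_smul, neg_sq] at h2
    have h3 := Real.cos_sq_add_sin_sq θ
    have h4 : Real.sin θ ^ 2 = 0 := by
      nlinarith [sq_nonneg (Real.cos θ), sq_nonneg (Real.sin θ)]
    have h5 : Real.cos θ ^ 2 = 0 := by
      rw [h4, zero_mul] at h2
      exact (mul_eq_zero.1 h2).resolve_right hGx.ne
    linarith
  · rw [quadForm_smul_add_smul hB, hBx, hBy, hxy]; ring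

/-- The connectedness fact behind Brickman's theorem: in dimension at least three the isotropic
cone of `B` is connected up to sign, so a second form `G` that takes both signs on it vanishes
somewhere on it. -/
theorem exists_common_zero_of_notMem_span {B G : Matrix (Fin n) (Fin n) ℝ} (hB : B.IsSymm)
    {N : Submodule ℝ (Fin n → ℝ)} {x y w : Fin n → ℝ} (hx : x ∈ N) (hy : y ∈ N)
    (hw : w ∈ N) (hws : w ∉ Submodule.span ℝ {x, y})
    (hBx : quadForm B x = 0) (hBy : quadForm B y = 0)
    (hGx : quadForm G x < 0) (hGy : 0 < quadForm G y) :
    ∃ z ∈ N, z ≠ 0 ∧ quadForm B z = 0 ∧ quadForm G z = 0 := by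
  by_cases hb : x ⬝ᵥ (B *ᵥ y) = 0
  · exact exists_common_zero_of_orthogonal hB hx hy hBx hBy hb hGx hGy
  set b := x ⬝ᵥ (B *ᵥ y) with hbdef
  have hbyx : y ⬝ᵥ (B *ᵥ x) = b := dotProduct_mulVec_comm_of_isSymm hB y x
  -- The component of `w` that is `B`-orthogonal to the hyperbolic plane spanned by `x` and `y`.
  obtain ⟨v, hv, hvs, hxv, hyv⟩ : ∃ v ∈ N, v ∉ Submodule.span ℝ {x, y} ∧
      x ⬝ᵥ (B *ᵥ v) = 0 ∧ y ⬝ᵥ (B *ᵥ v) = 0 := by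
    have hmem : ((y ⬝ᵥ (B *ᵥ w)) / b) • x + ((x ⬝ᵥ (B *ᵥ w)) / b) • y ∈
        Submodule.span ℝ {x, y} := Submodule.mem_span_pair.2 ⟨_, _, rfl⟩
    refine ⟨w - (((y ⬝ᵥ (B *ᵥ w)) / b) • x + ((x ⬝ᵥ (B *ᵥ w)) / b) • y), ?_, ?_, ?_, ?_⟩
    · exact N.sub_mem hw (N.add_mem (N.smul_mem _ hx) (N.smul_mem _ hy))
    · exact fun h => hws (by simpa using Submodule.add_mem _ h hmem)
    · simp only [Matrix.mulVec_sub, Matrix.mulVec_add, Matrix.mulVec_smul, dotProduct_sub,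
        dotProduct_add, dotProduct_smul, smul_eq_mul, ← hbdef]
      rw [show x ⬝ᵥ (B *ᵥ x) = 0 from hBx]
      field_simp; ring
    · simp only [Matrix.mulVec_sub, Matrix.mulVec_add, Matrix.mulVec_smul, dotProduct_sub,
        dotProduct_add, dotProduct_smul, smul_eq_mul, hbyx]
      rw [show y ⬝ᵥ (B *ᵥ y) = 0 from hBy]
      field_simp; ring
  have hv0 : v ≠ 0 := fun h => hvs (h ▸ Submodule.zero_mem _)
  by_cases hs : quadForm B v = 0
  · rcases lt_trichotomy (quadForm G v) 0 with hG | hG | hG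
    · exact exists_common_zero_of_orthogonal hB hv hy hs hBy
        ((dotProduct_mulVec_comm_of_isSymm hB v y).trans hyv) hG hGy
    · exact ⟨v, hv, hv0, hs, hG⟩
    · exact exists_common_zero_of_orthogonal hB hx hv hBx hs hxv hGx hG
  -- Up to the sign of `y`, the isotropic cone contains a path from `x` to `y` through `v`.
  obtain ⟨σ, g, hσ, hσg⟩ : ∃ σ g : ℝ, σ ^ 2 = 1 ∧ 2 * σ * b + g ^ 2 * quadForm B v = 0 := by
    rcases lt_or_gt_of_ne (div_ne_zero hb hs) with h | h
    · refine ⟨1, Real.sqrt (2 * -(b / quadForm B v)), by norm_num, ?_⟩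
      rw [Real.sq_sqrt (by linarith)]; field_simp; ring
    · refine ⟨-1, Real.sqrt (2 * (b / quadForm B v)), by norm_num, ?_⟩
      rw [Real.sq_sqrt (by linarith)]; field_simp; ring
  have hc : Continuous fun θ : ℝ => quadForm G (((Real.cos θ) ^ 2 • x +
      (Real.sin θ ^ 2 * σ) • y) + (Real.cos θ * Real.sin θ * g) • v) := by fun_prop
  obtain ⟨θ, hθ⟩ := mem_range_of_exists_le_of_exists_ge hc (c := 0)
    ⟨0, by simpa using hGx.le⟩
    ⟨Real.pi / 2, by simpa [quadForm_smul, hσ] using hGy.le⟩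
  refine ⟨_, N.add_mem (N.add_mem (N.smul_mem _ hx) (N.smul_mem _ hy)) (N.smul_mem _ hv),
    fun h0 => ?_, ?_, hθ⟩
  · have hcs : Real.cos θ * Real.sin θ * g = 0 := by
      by_contra hne
      refine hvs (((Submodule.span ℝ {x, y}).smul_mem_iff hne).1 ?_)
      rw [eq_neg_of_add_eq_zero_right h0]
      exact Submodule.neg_mem _ (Submodule.mem_span_pair.2 ⟨_, _, rfl⟩)
    have hg : g ≠ 0 := by
      rintro rfl
      have : σ ≠ 0 := by rintro rfl; norm_num at hσ
      simp_all
    have hsum := Real.cos_sq_add_sin_sq θ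
    rcases mul_eq_zero.1 ((mul_eq_zero.1 hcs).resolve_right hg) with h | h
    · have h1 : Real.sin θ ^ 2 = 1 := by rw [h] at hsum; linarith
      simp only [h, h1, zero_pow, ne_eq, OfNat.ofNat_ne_zero, not_false_eq_true, zero_smul,
        zero_mul, one_mul, zero_add, add_zero] at hθ
      rw [quadForm_smul, hσ] at hθ
      linarith
    · have h1 : Real.cos θ ^ 2 = 1 := by rw [h] at hsum; linarith
      simp only [h, h1, zero_pow, ne_eq, OfNat.ofNat_ne_zero, not_false_eq_true, zero_smul,
        zero_mul, mul_zero, one_smul, add_zero] at hθ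
      linarith
  · rw [← one_smul ℝ ((Real.cos θ) ^ 2 • x + (Real.sin θ ^ 2 * σ) • y),
      quadForm_smul_add_smul hB, quadForm_smul_add_smul hB, hBx, hBy, ← hbdef,
      add_dotProduct, smul_dotProduct, smul_dotProduct, hxv, hyv]
    simp only [smul_eq_mul]
    linear_combination (Real.cos θ) ^ 2 * (Real.sin θ) ^ 2 * hσg

/-! ### Decomposition into isotropic vectors -/

/-- Two vectors on which `F` has opposite signs can be rotated in their plane so that the first
becomes `F`-isotropic; the sum of the values of any quadratic form is unchanged. -/
theorem exists_rotation_quadForm_eq_zero (F : Matrix (Fin n) (Fin n) ℝ)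
    {N : Submodule ℝ (Fin n → ℝ)} {x y : Fin n → ℝ} (hx : x ∈ N) (hy : y ∈ N)
    (hxy : quadForm F x * quadForm F y < 0) :
    ∃ z ∈ N, ∃ z' ∈ N, quadForm F z = 0 ∧
      ∀ M : Matrix (Fin n) (Fin n) ℝ, M.IsSymm →
        quadForm M z + quadForm M z' = quadForm M x + quadForm M y := by
  have hc : Continuous fun θ : ℝ => quadForm F (Real.cos θ • x + Real.sin θ • y) := by fun_prop
  have h0 : ∃ θ : ℝ, quadForm F (Real.cos θ • x + Real.sin θ • y) = 0 := by
    rcases mul_neg_iff.1 hxy with ⟨h1, h2⟩ | ⟨h1, h2⟩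
    · exact mem_range_of_exists_le_of_exists_ge hc
        ⟨Real.pi / 2, by simpa using h2.le⟩ ⟨0, by simpa using h1.le⟩
    · exact mem_range_of_exists_le_of_exists_ge hc
        ⟨0, by simpa using h1.le⟩ ⟨Real.pi / 2, by simpa using h2.le⟩
  obtain ⟨θ, hθ⟩ := h0
  refine ⟨_, N.add_mem (N.smul_mem _ hx) (N.smul_mem _ hy),
    (-Real.sin θ) • x + Real.cos θ • y, N.add_mem (N.smul_mem _ hx) (N.smul_mem _ hy), hθ,
    fun M hM => ?_⟩
  rw [quadForm_smul_add_smul hM, quadForm_smul_add_smul hM]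
  linear_combination (quadForm M x + quadForm M y) * Real.cos_sq_add_sin_sq θ

/-- The rank-one decomposition of Sturm and Zhang: if `∑ F[x] = 0` over finitely many vectors,
then the matrix `∑ x xᵀ` is also a sum `∑ z zᵀ` over `F`-isotropic vectors. The matrix is
represented by the values of all symmetric quadratic forms on it. -/
theorem exists_isotropic_decomposition {F : Matrix (Fin n) (Fin n) ℝ} (hF : F.IsSymm)
    {N : Submodule ℝ (Fin n → ℝ)} (s : Multiset (Fin n → ℝ)) (hsN : ∀ x ∈ s, x ∈ N)
    (hs : (s.map (quadForm F)).sum = 0) :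
    ∃ t : Multiset (Fin n → ℝ), (∀ z ∈ t, z ∈ N) ∧ (∀ z ∈ t, quadForm F z = 0) ∧
      ∀ M : Matrix (Fin n) (Fin n) ℝ, M.IsSymm →
        (t.map (quadForm M)).sum = (s.map (quadForm M)).sum := by
  induction hk : s.card generalizing s with
  | zero => exact ⟨s, hsN, by simp [Multiset.card_eq_zero.1 hk], fun _ _ => rfl⟩
  | succ k ih =>
    obtain ⟨x, t, rfl⟩ : ∃ x t, s = x ::ₘ t := by
      obtain ⟨x, hx⟩ := Multiset.card_pos_iff_exists_mem.1 (by omega : 0 < s.card)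
      exact ⟨x, Multiset.exists_cons_of_mem hx⟩
    simp only [Multiset.map_cons, Multiset.sum_cons] at hs
    rw [Multiset.card_cons, add_left_inj] at hk
    by_cases hx : quadForm F x = 0
    · obtain ⟨t', h1, h2, h3⟩ := ih t (fun y hy => hsN y (Multiset.mem_cons_of_mem hy))
        (by linarith) hk
      refine ⟨x ::ₘ t', ?_, ?_, fun M hM => by simp [h3 M hM]⟩
      · simpa using ⟨hsN x (Multiset.mem_cons_self _ _), h1⟩
      · simpa using ⟨hx, h2⟩
    obtain ⟨y, hyt, hxy⟩ : ∃ y ∈ t, quadForm F x * quadForm F y < 0 := by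
      by_contra! hcon
      have h1 : 0 ≤ (t.map fun y => quadForm F x * quadForm F y).sum :=
        Multiset.sum_nonneg (by simpa using hcon)
      rw [Multiset.sum_map_mul_left] at h1
      have : (t.map (quadForm F)).sum = -quadForm F x := by linarith
      change 0 ≤ quadForm F x * (t.map (quadForm F)).sum at h1
      rw [this] at h1
      nlinarith [sq_pos_of_ne_zero hx]
    obtain ⟨t, rfl⟩ := Multiset.exists_cons_of_mem hyt
    obtain ⟨z, hz, z', hz', hFz, hM⟩ := exists_rotation_quadForm_eq_zero F
      (hsN x (by simp)) (hsN y (by simp)) hxy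
    simp only [Multiset.map_cons, Multiset.sum_cons] at hs
    have hFF := hM F hF
    obtain ⟨t', h1, h2, h3⟩ := ih (z' ::ₘ t)
      (by
        intro u hu
        rcases Multiset.mem_cons.1 hu with rfl | hu
        · exact hz'
        · exact hsN u (by simp [hu]))
      (by simp only [Multiset.map_cons, Multiset.sum_cons]; linarith) (by simpa using hk)
    refine ⟨z ::ₘ t', ?_, ?_, fun M hMs => ?_⟩
    · simpa using ⟨hz, h1⟩
    · simpa using ⟨hFz, h2⟩
    · have := h3 M hMs
      simp only [Multiset.map_cons, Multiset.sum_cons] at this ⊢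
      linarith [hM M hMs]

/-- If `B` and `G` have no common zero in `N` but both sum to zero over a nontrivial family in
`N`, then `G` takes both signs on the isotropic cone of `B`. -/
theorem exists_isotropic_pair {B G : Matrix (Fin n) (Fin n) ℝ} (hB : B.IsSymm) (hG : G.IsSymm)
    {N : Submodule ℝ (Fin n → ℝ)}
    (hno : ∀ z ∈ N, quadForm B z = 0 → quadForm G z = 0 → z = 0)
    {s : Multiset (Fin n → ℝ)} (hsN : ∀ x ∈ s, x ∈ N)
    (hsB : (s.map (quadForm B)).sum = 0) (hsG : (s.map (quadForm G)).sum = 0)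
    (hs1 : (s.map (quadForm 1)).sum = 1) :
    ∃ x ∈ N, ∃ y ∈ N, quadForm B x = 0 ∧ quadForm B y = 0 ∧
      quadForm G x < 0 ∧ 0 < quadForm G y := by
  obtain ⟨t, htN, htB, ht⟩ := exists_isotropic_decomposition hB s hsN hsB
  have htG := (ht G hG).trans hsG
  have ht1 := (ht 1 Matrix.isSymm_one).trans hs1
  have hne : ∃ x ∈ t, quadForm G x ≠ 0 := by
    by_contra! h
    have : t.map (quadForm (1 : Matrix (Fin n) (Fin n) ℝ)) = t.map fun _ => (0 : ℝ) :=
      Multiset.map_congr rfl fun z hz => by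
        rw [hno z (htN z hz) (htB z hz) (h z hz), quadForm_zero_right]
    rw [this] at ht1
    simp at ht1
  have hneg : ∃ x ∈ t, quadForm G x < 0 := by
    by_contra! h
    obtain ⟨x, hx, hx0⟩ := hne
    have := Multiset.single_le_sum (s := t.map (quadForm G)) (by simpa using h) _
      (Multiset.mem_map_of_mem _ hx)
    exact hx0 (le_antisymm (htG ▸ this) (h x hx))
  have hpos : ∃ x ∈ t, 0 < quadForm G x := by
    by_contra! h
    obtain ⟨x, hx, hx0⟩ := hne
    have := Multiset.single_le_sum (s := t.map fun z => -quadForm G z) (by simpa using h) _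
      (Multiset.mem_map_of_mem _ hx)
    rw [Multiset.sum_map_neg, htG] at this
    exact hx0 (le_antisymm (h x hx) (by linarith))
  obtain ⟨x, hx, hxG⟩ := hneg
  obtain ⟨y, hy, hyG⟩ := hpos
  exact ⟨x, htN x hx, y, htN y hy, htB x hx, htB y hy, hxG, hyG⟩


/-! ### Separation from a negative orthant -/

/-- A convex set that misses the open orthant below `a` is separated from it by a nonzero
functional with nonnegative coefficients. -/
theorem exists_nonneg_separating {ι : Type*} [Fintype ι] {C : Set (ι → ℝ)} (hC : Convex ℝ C)
    (hne : C.Nonempty) (a : ι → ℝ) (hdisj : ∀ v ∈ C, ∃ k, a k ≤ v k) :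
    ∃ ν : ι → ℝ, (∀ k, 0 ≤ ν k) ∧ ν ≠ 0 ∧ ∀ v ∈ C, ∑ k, ν k * a k ≤ ∑ k, ν k * v k := by
  classical
  set D : Set (ι → ℝ) := Set.univ.pi fun k => Set.Iio (a k)
  have hDo : IsOpen D := isOpen_set_pi Set.finite_univ fun k _ => isOpen_Iio
  have hDc : Convex ℝ D := convex_pi fun k _ => convex_Iio _
  obtain ⟨f, u, hfD, hfC⟩ := geometric_hahn_banach_open hDc hDo hC <| by
    rw [Set.disjoint_left]
    intro v hv hvC
    obtain ⟨k, hk⟩ := hdisj v hvC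
    exact absurd (hv k trivial) (not_lt.2 hk)
  have hf : ∀ v, f v = ∑ k, f (Pi.single k 1) * v k := fun v => by
    conv_lhs => rw [← Finset.univ_sum_single v, map_sum]
    refine Finset.sum_congr rfl fun k _ => ?_
    rw [show (Pi.single k (v k) : ι → ℝ) = v k • Pi.single k (1 : ℝ) by
      rw [← Pi.single_smul, smul_eq_mul, mul_one], map_smul, smul_eq_mul, mul_comm]
  have hlow : ∀ w : ι → ℝ, (∀ k, 0 < w k) → f a - f w < u := fun w hw => by
    rw [← map_sub]
    exact hfD _ fun k _ => by simpa using hw k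
  have hau : f a ≤ u := by
    refine le_of_forall_pos_lt_add fun ε hε => ?_
    set c := f fun _ => (1 : ℝ) with hc
    have hδ : 0 < ε / (|c| + 1) := by positivity
    have h := hlow ((ε / (|c| + 1)) • fun _ => 1) fun k => by simpa using hδ
    rw [map_smul, smul_eq_mul, ← hc] at h
    have h2 : ε / (|c| + 1) * c < ε := by
      rw [div_mul_eq_mul_div, div_lt_iff₀ (by positivity)]
      nlinarith [le_abs_self c]
    linarith
  refine ⟨fun k => f (Pi.single k 1), fun k => ?_, fun h0 => ?_, fun v hv => ?_⟩
  · by_contra! hneg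
    -- Along `-eₖ` the functional would be unbounded above on the orthant.
    set c := f fun _ => (1 : ℝ) with hc
    set T := |u - f a + c| / -(f (Pi.single k 1)) with hT
    have hT0 : 0 ≤ T := div_nonneg (abs_nonneg _) (by linarith)
    have h := hlow ((fun _ => 1) + T • Pi.single k 1) fun j => by
      have : 0 ≤ (T • Pi.single k (1 : ℝ) : ι → ℝ) j := by
        by_cases hj : j = k
        · subst hj; simpa using hT0
        · simp [hj]
      simp only [Pi.add_apply]
      linarith
    rw [map_add, map_smul, smul_eq_mul, ← hc] at h
    have h2 : T * f (Pi.single k 1) = -|u - f a + c| := by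
      rw [hT, div_mul_eq_mul_div, div_neg, mul_div_cancel_right₀ _ hneg.ne]
    have := le_abs_self (u - f a + c)
    linarith
  · have hf0 : ∀ v, f v = 0 := fun v => by
      rw [hf]
      exact Finset.sum_eq_zero fun k _ => by
        rw [show f (Pi.single k 1) = 0 from congrFun h0 k, zero_mul]
    obtain ⟨v, hv⟩ := hne
    have h1 := hlow (fun _ => 1) fun _ => one_pos
    have h2 := hfC v hv
    simp only [hf0] at h1 h2
    linarith
  · rw [← hf, ← hf]
    exact hau.trans (hfC v hv)

/-! ### The joint range over density matrices -/

/-- The set of triples `(tr (A k * X))ₖ`, with `X` positive semidefinite of trace one. The matrix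
`X = Yᵀ Y` is encoded by the rows of a square matrix `Y`, so that `tr (A k * X)` is the sum of the
values of the form `A k` on these rows. It is the convex hull of the joint range of the forms on
the unit sphere. -/
def densityRange {ι : Type*} (A : ι → Matrix (Fin n) (Fin n) ℝ) : Set (ι → ℝ) :=
  (fun (Y : Fin n → Fin n → ℝ) k => ∑ i, quadForm (A k) (Y i)) '' {Y | ∑ i, Y i ⬝ᵥ Y i = 1}

theorem isCompact_densityRange {ι : Type*} (A : ι → Matrix (Fin n) (Fin n) ℝ) :
    IsCompact (densityRange A) := by
  refine IsCompact.image ?_ (by fun_prop)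
  have hK : IsCompact (Set.univ.pi fun _ : Fin n => Set.univ.pi fun _ : Fin n =>
      Set.Icc (-1 : ℝ) 1) :=
    isCompact_univ_pi fun _ => isCompact_univ_pi fun _ => isCompact_Icc
  refine hK.of_isClosed_subset (isClosed_eq (by fun_prop) continuous_const) fun Y hY => ?_
  intro i _ j _
  have h1 : Y i ⬝ᵥ Y i ≤ 1 := by
    rw [← (show ∑ i, Y i ⬝ᵥ Y i = 1 from hY)]
    exact Finset.single_le_sum (f := fun i => Y i ⬝ᵥ Y i)
      (fun i _ => Finset.sum_nonneg fun j _ => mul_self_nonneg _) (Finset.mem_univ i)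
  have h2 : Y i j * Y i j ≤ Y i ⬝ᵥ Y i :=
    Finset.single_le_sum (f := fun j => Y i j * Y i j)
      (fun j _ => mul_self_nonneg _) (Finset.mem_univ j)
  exact abs_le.1 (abs_le_one_iff_mul_self_le_one.2 (h2.trans h1))

theorem sum_quadForm_row (M Y : Matrix (Fin n) (Fin n) ℝ) :
    ∑ i, quadForm M (Y i) = (M * (Yᵀ * Y)).trace := by
  rw [← Matrix.mul_assoc, Matrix.trace_mul_comm, Matrix.trace]
  refine Finset.sum_congr rfl fun i _ => ?_
  rw [Matrix.diag_apply, Matrix.mul_apply, quadForm]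
  rfl

open scoped MatrixOrder in
theorem exists_eq_transpose_mul_self {P : Matrix (Fin n) (Fin n) ℝ} (hP : P.PosSemidef) :
    ∃ W : Matrix (Fin n) (Fin n) ℝ, P = Wᵀ * W :=
  CStarAlgebra.nonneg_iff_eq_star_mul_self.1 hP.nonneg

theorem convex_densityRange {ι : Type*} (A : ι → Matrix (Fin n) (Fin n) ℝ) :
    Convex ℝ (densityRange A) := by
  rintro _ ⟨Y, hY, rfl⟩ _ ⟨Y', hY', rfl⟩ a b ha hb hab
  have hpsd : ∀ Y : Matrix (Fin n) (Fin n) ℝ, (Yᵀ * Y).PosSemidef := fun Y => by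
    simpa using Matrix.posSemidef_conjTranspose_mul_self Y
  obtain ⟨W, hW⟩ := exists_eq_transpose_mul_self
    (((hpsd Y).smul ha).add ((hpsd Y').smul hb))
  have key : ∀ M : Matrix (Fin n) (Fin n) ℝ, ∑ i, quadForm M (W i) =
      a * ∑ i, quadForm M (Y i) + b * ∑ i, quadForm M (Y' i) := fun M => by
    erw [sum_quadForm_row, sum_quadForm_row, sum_quadForm_row]
    rw [← hW]
    simp [Matrix.mul_add]
  refine ⟨W, ?_, ?_⟩
  · have := key 1
    simp only [quadForm_one] at this
    rw [Set.mem_ofPred_eq] at hY hY'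
    change ∑ i, W i ⬝ᵥ W i = 1
    rw [this, hY, hY']
    linarith
  · ext k
    simp [key (A k)]

theorem mem_densityRange_of_dotProduct_self {ι : Type*} (A : ι → Matrix (Fin n) (Fin n) ℝ)
    {x : Fin n → ℝ} (hx : x ⬝ᵥ x = 1) : (fun k => quadForm (A k) x) ∈ densityRange A := by
  have hx0 : x ≠ 0 := by rintro rfl; simp at hx
  obtain ⟨i, -⟩ := Function.ne_iff.1 hx0
  have key : ∀ M : Matrix (Fin n) (Fin n) ℝ,
      ∑ j, quadForm M ((Pi.single i x : Fin n → Fin n → ℝ) j) = quadForm M x := fun M => by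
    rw [Finset.sum_eq_single i (fun j _ hj => by simp [hj]) (by simp)]
    simp
  refine ⟨Pi.single i x, ?_, ?_⟩
  · have := key 1
    simp only [quadForm_one] at this
    exact this.trans hx
  · ext k
    exact key (A k)

theorem exists_smul_dotProduct_self_eq_one {x : Fin n → ℝ} (hx : x ≠ 0) :
    ∃ c : ℝ, c ≠ 0 ∧ c ^ 2 * (x ⬝ᵥ x) = 1 := by
  have hpos : 0 < x ⬝ᵥ x := by simpa using Matrix.dotProduct_star_self_pos_iff.2 hx
  refine ⟨(Real.sqrt (x ⬝ᵥ x))⁻¹, by positivity, ?_⟩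
  rw [inv_pow, Real.sq_sqrt hpos.le, inv_mul_cancel₀ hpos.ne']

theorem mul_dotProduct_self_le_of_densityRange {ι : Type*} [Fintype ι]
    {A : ι → Matrix (Fin n) (Fin n) ℝ} {ν : ι → ℝ} {m : ℝ}
    (h : ∀ v ∈ densityRange A, m ≤ ∑ k, ν k * v k) (x : Fin n → ℝ) :
    m * (x ⬝ᵥ x) ≤ ∑ k, ν k * quadForm (A k) x := by
  rcases eq_or_ne x 0 with rfl | hx
  · simp
  obtain ⟨c, hc, hcx⟩ := exists_smul_dotProduct_self_eq_one hx
  have h1 := h _ (mem_densityRange_of_dotProduct_self A (x := c • x)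
    (by simp only [smul_dotProduct, dotProduct_smul, smul_eq_mul]; linarith))
  simp only [← quadForm_sum_smul] at h1 ⊢
  rw [quadForm_smul] at h1
  have hc2 : 0 < c ^ 2 := by positivity
  refine le_of_mul_le_mul_left ?_ hc2
  linear_combination h1 + m * hcx

/-! ### Three forms without a semidefinite combination -/

/-- A zero of an indefinite form can be moved, by arbitrarily small perturbations, to where the
form is negative. -/
theorem exists_perturbation_quadForm_neg {A : Matrix (Fin n) (Fin n) ℝ} (hA : A.IsSymm)
    {x : Fin n → ℝ} (hx : quadForm A x = 0) (hneg : ∃ y, quadForm A y < 0) :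
    ∃ y : Fin n → ℝ, ∀ ε : ℝ, 0 < ε → quadForm A (x + ε • y) < 0 := by
  obtain ⟨y, hy⟩ := hneg
  -- Replacing `y` by `-y` makes the cross term nonpositive.
  obtain ⟨σ, hσ, hσy⟩ : ∃ σ : ℝ, σ ^ 2 = 1 ∧ σ * (x ⬝ᵥ (A *ᵥ y)) ≤ 0 := by
    rcases le_total (x ⬝ᵥ (A *ᵥ y)) 0 with h | h
    · exact ⟨1, by norm_num, by linarith⟩
    · exact ⟨-1, by norm_num, by linarith⟩
  refine ⟨σ • y, fun ε hε => ?_⟩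
  have h := quadForm_smul_add_smul hA 1 (ε * σ) x y
  rw [one_smul, mul_smul, hx] at h
  rw [h, mul_pow, hσ]
  nlinarith [mul_pos hε hε, mul_nonneg hε.le (neg_nonneg.2 hσy)]

theorem eventually_quadForm_add_smul_neg {A : Matrix (Fin n) (Fin n) ℝ} {x y : Fin n → ℝ}
    (hx : quadForm A x < 0) :
    ∀ᶠ ε : ℝ in nhdsWithin 0 (Set.Ioi 0), quadForm A (x + ε • y) < 0 := by
  have hc : ContinuousAt (fun ε : ℝ => quadForm A (x + ε • y)) 0 := by fun_prop
  exact (hc.eventually_lt continuousAt_const (by simpa using hx)).filter_mono nhdsWithin_le_nhds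

/-- If none of three forms is positive semidefinite, the weak system
`A₀ < 0, A₁ ≤ 0, A₂ ≤ 0` is no easier to solve than the strict system and the system
`A₀ < 0, A₁ = A₂ = 0`. -/
theorem not_exists_neg_nonpos_nonpos {A : Fin 3 → Matrix (Fin n) (Fin n) ℝ}
    (hA : ∀ k, (A k).IsSymm) (hmax : ∀ x, ∃ k, 0 ≤ quadForm (A k) x)
    (hsys : ¬ ∃ x, quadForm (A 0) x < 0 ∧ quadForm (A 1) x = 0 ∧ quadForm (A 2) x = 0)
    (hneg : ∀ k, ∃ x, quadForm (A k) x < 0) {x : Fin n → ℝ} (h0 : quadForm (A 0) x < 0)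
    (h1 : quadForm (A 1) x ≤ 0) (h2 : quadForm (A 2) x ≤ 0) : False := by
  have key : ∀ i j k : Fin 3, (∀ l, l = i ∨ l = j ∨ l = k) → quadForm (A i) x < 0 →
      quadForm (A j) x < 0 → quadForm (A k) x = 0 → False := fun i j k hl hi hj hk => by
    obtain ⟨y, hy⟩ := exists_perturbation_quadForm_neg (hA k) hk (hneg k)
    obtain ⟨ε, ⟨hεi, hεj⟩, hε⟩ := ((eventually_quadForm_add_smul_neg (y := y) hi).and
      (eventually_quadForm_add_smul_neg (y := y) hj) |>.and self_mem_nhdsWithin).exists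
    obtain ⟨l, hl0⟩ := hmax (x + ε • y)
    rcases hl l with rfl | rfl | rfl
    · linarith
    · linarith
    · linarith [hy ε hε]
  rcases h1.lt_or_eq with h1 | h1 <;> rcases h2.lt_or_eq with h2 | h2
  · obtain ⟨k, hk⟩ := hmax x
    fin_cases k <;> simp at hk <;> linarith
  · exact key 0 1 2 (by decide) h0 h1 h2
  · exact key 0 2 1 (by decide) h0 h2 h1
  · exact hsys ⟨x, h0, h1, h2⟩

/-- The dual certificate: if `m = -μ₃` is the minimum of `A₀` over density matrices on which `A₁`
and `A₂` are nonpositive, then some form `A₀ + μ₁ A₁ + μ₂ A₂ - m` is semidefinite, and a minimizer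
is a sum `∑ x xᵀ` over null vectors of this form that satisfies complementary slackness. -/
theorem exists_dual_certificate {A : Fin 3 → Matrix (Fin n) (Fin n) ℝ}
    (hnot : ∀ ν : Fin 3 → ℝ, (∀ k, 0 ≤ ν k) → ν ≠ 0 → ∃ x, ∑ k, ν k * quadForm (A k) x < 0) :
    ∃ (μ₁ μ₂ μ₃ : ℝ) (s : Multiset (Fin n → ℝ)), 0 ≤ μ₁ ∧ 0 ≤ μ₂ ∧ 0 < μ₃ ∧
      (∀ x, 0 ≤ quadForm (A 0 + μ₁ • A 1 + μ₂ • A 2 + μ₃ • 1) x) ∧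
      (∀ x ∈ s, quadForm (A 0 + μ₁ • A 1 + μ₂ • A 2 + μ₃ • 1) x = 0) ∧
      (s.map (quadForm 1)).sum = 1 ∧
      (s.map (quadForm (A 1))).sum ≤ 0 ∧ (s.map (quadForm (A 2))).sum ≤ 0 ∧
      μ₁ * (s.map (quadForm (A 1))).sum = 0 ∧ μ₂ * (s.map (quadForm (A 2))).sum = 0 := by
  have hne : (densityRange A).Nonempty := by
    obtain ⟨x, hx⟩ := hnot (fun _ => 1) (fun _ => zero_le_one)
      (fun h => one_ne_zero (congrFun h 0))
    have hx0 : x ≠ 0 := by rintro rfl; simp at hx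
    obtain ⟨c, hc, hcx⟩ := exists_smul_dotProduct_self_eq_one hx0
    exact ⟨_, mem_densityRange_of_dotProduct_self A (x := c • x)
      (by simp only [smul_dotProduct, dotProduct_smul, smul_eq_mul]; linarith)⟩
  obtain ⟨p, hpC, hp⟩ : ∃ p ∈ densityRange A, ∀ k, p k < 0 := by
    by_contra! hcon
    obtain ⟨ν, hν, hν0, hsep⟩ := exists_nonneg_separating (convex_densityRange A) hne 0 hcon
    obtain ⟨x, hx⟩ := hnot ν hν hν0
    have := mul_dotProduct_self_le_of_densityRange (m := 0) (by simpa using hsep) x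
    linarith
  -- The minimizer of the primal semidefinite program.
  obtain ⟨q, ⟨hqC, hq1, hq2⟩, hqmin⟩ :=
    ((isCompact_densityRange A).inter_right 
      ((isClosed_le (continuous_apply 1) continuous_const).inter
        (isClosed_le (continuous_apply 2) continuous_const) :
        IsClosed {v : Fin 3 → ℝ | v 1 ≤ 0 ∧ v 2 ≤ 0})).exists_isMinOn
      ⟨p, hpC, (hp 1).le, (hp 2).le⟩ (f := fun v => v 0) (by fun_prop)
  have hm : q 0 < 0 := (hqmin ⟨hpC, (hp 1).le, (hp 2).le⟩ : q 0 ≤ p 0).trans_lt (hp 0)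
  obtain ⟨ν, hν, hν0, hsep⟩ := exists_nonneg_separating (convex_densityRange A) hne
    ![q 0, 0, 0] fun v hv => by
      by_contra! hcon
      have h0 : v 0 < q 0 := hcon 0
      have h1 : v 1 < 0 := hcon 1
      have h2 : v 2 < 0 := hcon 2
      have h3 : q 0 ≤ v 0 := hqmin ⟨hv, h1.le, h2.le⟩
      linarith
  simp only [Fin.sum_univ_three, Matrix.cons_val_zero, Matrix.cons_val_one, Matrix.cons_val,
    mul_zero, add_zero] at hsep
  -- The strictly feasible point `p` rules out a vertical separating plane.
  have hν00 : 0 < ν 0 := by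
    refine (hν 0).lt_of_ne fun h => hν0 ?_
    have h1 := hsep p hpC
    rw [← h] at h1
    have e1 := mul_nonneg (hν 1) (neg_nonneg.2 (hp 1).le)
    have e2 := mul_nonneg (hν 2) (neg_nonneg.2 (hp 2).le)
    have z1 : ν 1 = 0 := (mul_eq_zero.1 (by linarith : ν 1 * p 1 = 0)).resolve_right (hp 1).ne
    have z2 : ν 2 = 0 := (mul_eq_zero.1 (by linarith : ν 2 * p 2 = 0)).resolve_right (hp 2).ne
    ext k
    fin_cases k
    · exact h.symm
    · exact z1
    · exact z2
  obtain ⟨Y, hY, hYq⟩ := hqC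
  have hYs : ∀ k, ∑ i, quadForm (A k) (Y i) = q k := fun k => congrFun hYq k
  set Z := A 0 + (ν 1 / ν 0) • A 1 + (ν 2 / ν 0) • A 2 + (-q 0) • (1 : Matrix (Fin n) (Fin n) ℝ)
    with hZ
  have hZx : ∀ x, quadForm Z x = quadForm (A 0) x + ν 1 / ν 0 * quadForm (A 1) x +
      ν 2 / ν 0 * quadForm (A 2) x + -q 0 * quadForm 1 x := fun x => by
    simp only [hZ, quadForm_add, quadForm_smul_left]
  have hZnn : ∀ x, 0 ≤ quadForm Z x := fun x => by
    have h := mul_dotProduct_self_le_of_densityRange (A := A) (ν := ν) (m := ν 0 * q 0)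
      (by simpa [Fin.sum_univ_three] using hsep) x
    rw [Fin.sum_univ_three] at h
    refine nonneg_of_mul_nonneg_right ?_ hν00
    rw [hZx, quadForm_one]
    have e : ν 0 * (quadForm (A 0) x + ν 1 / ν 0 * quadForm (A 1) x +
        ν 2 / ν 0 * quadForm (A 2) x + -q 0 * (x ⬝ᵥ x)) = ν 0 * quadForm (A 0) x +
        ν 1 * quadForm (A 1) x + ν 2 * quadForm (A 2) x - ν 0 * q 0 * (x ⬝ᵥ x) := by
      field_simp; ring
    rw [e]; linarith
  have hY1 : ∑ i, quadForm 1 (Y i) = 1 := by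
    simp only [quadForm_one]
    exact hY
  have hZsum : ∑ i, quadForm Z (Y i) = ν 1 / ν 0 * q 1 + ν 2 / ν 0 * q 2 := by
    simp only [hZx, Finset.sum_add_distrib, ← Finset.mul_sum, hYs, hY1]
    ring
  have hμ1 : 0 ≤ ν 1 / ν 0 := div_nonneg (hν 1) hν00.le
  have hμ2 : 0 ≤ ν 2 / ν 0 := div_nonneg (hν 2) hν00.le
  have hZs0 : 0 ≤ ∑ i, quadForm Z (Y i) := Finset.sum_nonneg fun i _ => hZnn _
  have n1 := mul_nonneg hμ1 (neg_nonneg.2 hq1)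
  have n2 := mul_nonneg hμ2 (neg_nonneg.2 hq2)
  have hs : ∀ M : Matrix (Fin n) (Fin n) ℝ,
      (((Finset.univ : Finset (Fin n)).val.map Y).map (quadForm M)).sum =
        ∑ i, quadForm M (Y i) := fun M => by
    rw [Multiset.map_map]; rfl
  refine ⟨ν 1 / ν 0, ν 2 / ν 0, -q 0, (Finset.univ : Finset (Fin n)).val.map Y, hμ1, hμ2,
    by linarith, hZnn, ?_, ?_, ?_, ?_, ?_, ?_⟩
  · intro x hx
    obtain ⟨i, -, rfl⟩ := Multiset.mem_map.1 hx
    exact (Finset.sum_eq_zero_iff_of_nonneg fun i _ => hZnn (Y i)).1 (by linarith) i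
      (Finset.mem_univ i)
  · rw [hs, hY1]
  · rw [hs, hYs]; exact hq1
  · rw [hs, hYs]; exact hq2
  · rw [hs, hYs]; linarith
  · rw [hs, hYs]; linarith

/-- When no nonnegative combination of the forms is semidefinite and neither the strict system nor
the system `A₀ < 0, A₁ = A₂ = 0` is solvable, the dual certificate `Z` witnesses Property `IR`: its
kernel carries no common zero of `A₁` and `A₂`, which forces it to be a plane. -/
theorem propertyIR_of_forall_not_posSemidef {A : Fin 3 → Matrix (Fin n) (Fin n) ℝ}
    (hA : ∀ k, (A k).IsSymm) (hmax : ∀ x, ∃ k, 0 ≤ quadForm (A k) x)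
    (hsys : ¬ ∃ x, quadForm (A 0) x < 0 ∧ quadForm (A 1) x = 0 ∧ quadForm (A 2) x = 0)
    (hnot : ∀ ν : Fin 3 → ℝ, (∀ k, 0 ≤ ν k) → ν ≠ 0 → ∃ x, ∑ k, ν k * quadForm (A k) x < 0) :
    PropertyIR (A 0) (A 1) (A 2) := by
  have hneg : ∀ k, ∃ x, quadForm (A k) x < 0 := fun k => by
    obtain ⟨x, hx⟩ := hnot (Pi.single k 1)
      (fun j => by by_cases h : j = k <;> [(subst h; simp); simp [h]]) (by simp)
    exact ⟨x, by simpa [Pi.single_apply] using hx⟩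
  obtain ⟨μ₁, μ₂, μ₃, s, hμ₁, hμ₂, hμ₃, hZ, hsZ, hs1, hsA1, hsA2, hc1, hc2⟩ :=
    exists_dual_certificate hnot
  set Z := A 0 + μ₁ • A 1 + μ₂ • A 2 + μ₃ • (1 : Matrix (Fin n) (Fin n) ℝ) with hZdef
  have hZsymm : Z.IsSymm :=
    (((hA 0).add ((hA 1).smul _)).add ((hA 2).smul _)).add (Matrix.isSymm_one.smul _)
  have hZpsd : Z.PosSemidef := (posSemidef_iff_quadForm_nonneg hZsymm).2 hZ
  have hker : ∀ x, x ∈ LinearMap.ker Z.mulVecLin ↔ quadForm Z x = 0 := fun x => by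
    rw [LinearMap.mem_ker, Matrix.mulVecLin_apply, ← hZpsd.dotProduct_mulVec_zero_iff]
    rfl
  -- On the kernel of `Z`, the form `A₀` is determined by the other two.
  have hA0 : ∀ x ∈ LinearMap.ker Z.mulVecLin, quadForm (A 0) x =
      -(μ₁ * quadForm (A 1) x) - μ₂ * quadForm (A 2) x - μ₃ * (x ⬝ᵥ x) := fun x hx => by
    have h := (hker x).1 hx
    simp only [hZdef, quadForm_add, quadForm_smul_left, quadForm_one] at h
    linarith
  have hbad : ∀ x ∈ LinearMap.ker Z.mulVecLin, x ≠ 0 → quadForm (A 1) x ≤ 0 →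
      quadForm (A 2) x ≤ 0 → μ₁ * quadForm (A 1) x = 0 → μ₂ * quadForm (A 2) x = 0 → False :=
    fun x hx hx0 h1 h2 e1 e2 => by
      have hpos : 0 < x ⬝ᵥ x := by simpa using Matrix.dotProduct_star_self_pos_iff.2 hx0
      refine not_exists_neg_nonpos_nonpos hA hmax hsys hneg (x := x) ?_ h1 h2
      rw [hA0 x hx, e1, e2]
      nlinarith
  have hsN : ∀ x ∈ s, x ∈ LinearMap.ker Z.mulVecLin := fun x hx => (hker x).2 (hsZ x hx)
  set c₁ := (s.map (quadForm (A 1))).sum with hc₁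
  set c₂ := (s.map (quadForm (A 2))).sum with hc₂
  -- If `(c₁, c₂) ≠ 0`, decomposing along the form `c₂ A₁ - c₁ A₂` produces a single vector on
  -- which `(A₁, A₂)` is a positive multiple of `(c₁, c₂)`.
  have hc0 : c₁ = 0 ∧ c₂ = 0 := by
    by_contra hne
    have hd : 0 < c₁ ^ 2 + c₂ ^ 2 := by
      rcases not_and_or.1 hne with h | h <;> positivity
    have hsum : ∀ (a b : ℝ) (t : Multiset (Fin n → ℝ)),
        (t.map (quadForm (a • A 1 + b • A 2))).sum =
          a * (t.map (quadForm (A 1))).sum + b * (t.map (quadForm (A 2))).sum := fun a b t => by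
      have : quadForm (a • A 1 + b • A 2) =
          fun x => a * quadForm (A 1) x + b * quadForm (A 2) x := by
        ext x; simp only [quadForm_add, quadForm_smul_left]
      rw [this, Multiset.sum_map_add, Multiset.sum_map_mul_left, Multiset.sum_map_mul_left]
    have hsym : ∀ a b : ℝ, (a • A 1 + b • A 2).IsSymm := fun a b =>
      ((hA 1).smul _).add ((hA 2).smul _)
    obtain ⟨t, htN, htF, ht⟩ := exists_isotropic_decomposition (hsym c₂ (-c₁)) s hsN
      (by rw [hsum, ← hc₁, ← hc₂]; ring)
    obtain ⟨z, hz, hzpos⟩ : ∃ z ∈ t, 0 < quadForm (c₁ • A 1 + c₂ • A 2) z := by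
      by_contra! hcon
      have h1 : 0 ≤ (t.map fun z => -quadForm (c₁ • A 1 + c₂ • A 2) z).sum :=
        Multiset.sum_nonneg (by simpa using hcon)
      rw [Multiset.sum_map_neg, ht _ (hsym c₁ c₂), hsum, ← hc₁, ← hc₂] at h1
      nlinarith
    have hzF := htF z hz
    simp only [quadForm_add, quadForm_smul_left] at hzpos hzF
    set r := (c₁ * quadForm (A 1) z + c₂ * quadForm (A 2) z) / (c₁ ^ 2 + c₂ ^ 2) with hr
    have hr0 : 0 < r := div_pos hzpos hd
    have e1 : quadForm (A 1) z = r * c₁ := by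
      rw [hr, div_mul_eq_mul_div, eq_div_iff hd.ne']
      linear_combination c₂ * hzF
    have e2 : quadForm (A 2) z = r * c₂ := by
      rw [hr, div_mul_eq_mul_div, eq_div_iff hd.ne']
      linear_combination (-c₁) * hzF
    refine hbad z (htN z hz) ?_ ?_ ?_ ?_ ?_
    · rintro rfl; simp at hzpos
    · rw [e1]; nlinarith
    · rw [e2]; nlinarith
    · rw [e1]; linear_combination r * hc1
    · rw [e2]; linear_combination r * hc2
  have hno : ∀ z ∈ LinearMap.ker Z.mulVecLin, quadForm (A 1) z = 0 → quadForm (A 2) z = 0 →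
      z = 0 := fun z hz h1 h2 => by
    by_contra hz0
    exact hbad z hz hz0 h1.le h2.le (by rw [h1, mul_zero]) (by rw [h2, mul_zero])
  obtain ⟨x, hx, y, hy, hx1, hy1, hx2, hy2⟩ :=
    exists_isotropic_pair (hA 1) (hA 2) hno hsN hc0.1 hc0.2 hs1
  obtain ⟨x', hx', -, -, hx2', -, hx1', -⟩ :=
    exists_isotropic_pair (hA 2) (hA 1) (fun z hz h2 h1 => hno z hz h1 h2) hsN hc0.2 hc0.1 hs1
  have hne_zero : ∀ (M : Matrix (Fin n) (Fin n) ℝ) (z : Fin n → ℝ), quadForm M z < 0 → z ≠ 0 := by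
    rintro M z hz rfl
    simp at hz
  have hμ₁' : 0 < μ₁ := hμ₁.lt_of_ne fun h =>
    hbad x' hx' (hne_zero _ _ hx1') hx1'.le hx2'.le (by rw [← h, zero_mul]) (by rw [hx2', mul_zero])
  have hμ₂' : 0 < μ₂ := hμ₂.lt_of_ne fun h =>
    hbad x hx (hne_zero _ _ hx2) hx1.le hx2.le (by rw [hx1, mul_zero]) (by rw [← h, zero_mul])
  refine ⟨μ₁, μ₂, μ₃, x, y, hμ₁', hμ₂', hμ₃, hZpsd, le_antisymm ?_ ?_, hx1, hy1, ?_, hx2, hy2⟩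
  · rw [Submodule.span_le]
    rintro z (rfl | rfl)
    · exact hx
    · exact hy
  · intro w hw
    by_contra hws
    obtain ⟨z, hz, hz0, h1, h2⟩ :=
      exists_common_zero_of_notMem_span (hA 1) hx hy hw hws hx1 hy1 hx2 hy2
    exact hz0 (hno z hz h1 h2)
  · intro hxy
    obtain ⟨z, hz, hz0, h1, h2⟩ :=
      exists_common_zero_of_orthogonal (hA 1) hx hy hx1 hy1 hxy hx2 hy2
    exact hz0 (hno z hz h1 h2)

/-- A semidefinite combination with a positive coefficient at `B₀` excludes Property `IR`: at
the two `B₁`-isotropic vectors in the null space of `Z`, subtracting `ν₀ Z` leaves a multiple of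
`B₂` minus a positive multiple of the identity, while `B₂` has opposite signs there. -/
theorem not_propertyIR_of_nonneg {B₀ B₁ B₂ : Matrix (Fin n) (Fin n) ℝ} {ν₀ ν₁ ν₂ : ℝ}
    (hν₀ : 0 < ν₀)
    (h : ∀ x, 0 ≤ ν₀ * quadForm B₀ x + ν₁ * quadForm B₁ x + ν₂ * quadForm B₂ x) :
    ¬ PropertyIR B₀ B₁ B₂ := by
  rintro ⟨μ₁, μ₂, μ₃, x, y, -, -, hμ₃, -, hspan, hx1, hy1, -, hx2, hy2⟩
  have key : ∀ z ∈ ({x, y} : Set (Fin n → ℝ)), quadForm B₁ z = 0 → quadForm B₂ z ≠ 0 →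
      0 < (ν₂ - ν₀ * μ₂) * quadForm B₂ z := fun z hz hz1 hz2 => by
    have hz0 : z ≠ 0 := by rintro rfl; simp at hz2
    have hpos : 0 < z ⬝ᵥ z := by simpa using Matrix.dotProduct_star_self_pos_iff.2 hz0
    have hk := Submodule.subset_span (R := ℝ) hz
    rw [hspan, SetLike.mem_coe, LinearMap.mem_ker, Matrix.mulVecLin_apply] at hk
    have hq := congrArg (fun v => z ⬝ᵥ v) hk
    simp only [dotProduct_zero] at hq
    change quadForm _ z = 0 at hq
    simp only [quadForm_add, quadForm_smul_left, quadForm_one, hz1] at hq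
    have hz := h z
    rw [hz1] at hz
    have : 0 < ν₀ * μ₃ * (z ⬝ᵥ z) := by positivity
    linear_combination this + hz + ν₀ * hq
  have h1 := key x (by simp) hx1 hx2.ne
  have h2 := key y (by simp) hy1 hy2.ne'
  nlinarith [neg_of_mul_pos_left h1 hx2.le, pos_of_mul_pos_left h2 hy2.le]

end

theorem mainTheorem4 (n : ℕ) (A : Fin 3 → Matrix (Fin n) (Fin n) ℝ)
    (hA : ∀ k, (A k).IsSymm) :
    ((∀ x : Fin n → ℝ,
        0 ≤ max (quadForm (A 0) x) (max (quadForm (A 1) x) (quadForm (A 2) x))) ∧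
      ∃ j : Equiv.Perm (Fin 3),
        (¬ ∃ x : Fin n → ℝ, quadForm (A (j 0)) x < 0 ∧
          quadForm (A (j 1)) x = 0 ∧ quadForm (A (j 2)) x = 0) ∧
        ¬ PropertyIR (A (j 0)) (A (j 1)) (A (j 2))) ↔
    ∃ μ : Fin 3 → ℝ, (∀ k, 0 ≤ μ k) ∧ ∑ k, μ k = 1 ∧ (∑ k, μ k • A k).PosSemidef := by
  simp only [posSemidef_iff_quadForm_nonneg (isSymm_sum_smul _ hA), quadForm_sum_smul]
  constructor
  · rintro ⟨hmax, j, hsys, hIR⟩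
    by_contra! hnot
    refine hIR (propertyIR_of_forall_not_posSemidef (A := fun k => A (j k)) (fun k => hA (j k))
      (fun x => ?_) hsys fun ν hν hν0 => ?_)
    · have : ∃ k, 0 ≤ quadForm (A k) x := by
        rcases le_max_iff.1 (hmax x) with h | h
        · exact ⟨0, h⟩
        · rcases le_max_iff.1 h with h | h
          · exact ⟨1, h⟩
          · exact ⟨2, h⟩
      obtain ⟨k, hk⟩ := this
      exact ⟨j.symm k, by simpa using hk⟩
    · have hsum : 0 < ∑ k, ν k := by
        obtain ⟨k, hk⟩ := Function.ne_iff.1 hν0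
        exact Finset.sum_pos' (fun k _ => hν k) ⟨k, Finset.mem_univ k, (hν k).lt_of_ne' hk⟩
      obtain ⟨x, hx⟩ := hnot (fun k => ν (j.symm k) / ∑ k, ν k)
        (fun k => div_nonneg (hν _) hsum.le)
        (by rw [← Finset.sum_div, Equiv.sum_comp j.symm ν, div_self hsum.ne'])
      refine ⟨x, ?_⟩
      rw [← Equiv.sum_comp j] at hx
      simp only [Equiv.symm_apply_apply, div_mul_eq_mul_div, ← Finset.sum_div] at hx
      exact (div_neg_iff.1 hx).elim (fun h => absurd h.2 hsum.not_gt) fun h => h.1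
  · rintro ⟨μ, hμ, hμ1, hpsd⟩
    obtain ⟨i, hi⟩ : ∃ i, 0 < μ i := by
      by_contra! hcon
      have := Finset.sum_nonpos fun k (_ : k ∈ Finset.univ) => hcon k
      linarith
    refine ⟨fun x => ?_, Equiv.swap 0 i, ?_, ?_⟩
    · by_contra! hcon
      simp only [max_lt_iff] at hcon
      obtain ⟨h0, h1, h2⟩ := hcon
      have hlt : ∑ k, μ k * quadForm (A k) x < ∑ k : Fin 3, 0 := by
        have hk : ∀ k, quadForm (A k) x < 0 := by
          intro k; fin_cases k <;> assumption
        exact Finset.sum_lt_sum (fun k _ => mul_nonpos_of_nonneg_of_nonpos (hμ k) (hk k).le)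
          ⟨i, Finset.mem_univ i, mul_neg_of_pos_of_neg hi (hk i)⟩
      simp only [Finset.sum_const_zero] at hlt
      exact absurd (hpsd x) hlt.not_ge
    all_goals
      have hperm : ∀ x, 0 ≤ μ i * quadForm (A (Equiv.swap 0 i 0)) x +
          μ (Equiv.swap 0 i 1) * quadForm (A (Equiv.swap 0 i 1)) x +
          μ (Equiv.swap 0 i 2) * quadForm (A (Equiv.swap 0 i 2)) x := fun x => by
        have h := hpsd x
        rw [← Equiv.sum_comp (Equiv.swap 0 i), Fin.sum_univ_three] at h
        simpa using h
    · rintro ⟨x, h0, h1, h2⟩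
      have h := hperm x
      rw [h1, h2] at h
      nlinarith
    · exact not_propertyIR_of_nonneg hi hperm
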